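/- Let $\mathcal M$ be a modular lattice (with order $\preceq$ and minimum element $0$) that is graded and in which the lengths of all chains are bounded by a common finite number. Let $r:\mathcal M\to\mathbb Z$ be a grade function, i.e. $r$ is strictly increasing and $r(q)=r(p)+1$ whenever $q$ covers $p$. Let $K(\mathcal M)$ be the orthoscheme complex of $\mathcal M$: the set of formal convex combinations $x=\sum_p x_p\,p$ of elements of $\mathcal M$ whose support $\{p : x_p\neq 0\}$ is a finite chain. For a chain $p_0\prec p_1\prec\dots\prec p_n$, the simplex of all convex combinations of $p_0,\dots,p_n$ is mapped to a Euclidean space by $$\sum_i\lambda_i p_i\ \longmapsto\ \sum_{i}\lambda_i\,(e_1+e_2+\cdots+e_{r(p_i)-r(p_0)}),$$ and the distance of two points of a common simplex is the $l_2$-distance of their images. These distances determine neighbourhoods of the points and hence a topology on $K(\mathcal M)$. The length of a (continuous) path $P:[0,1]\to K(\mathcal M)$ is the supremum of $\sum_{i=1}^N d(P(t_{i-1}),P(t_i))$ over all subdivisions $0=t_0<t_1<\dots<t_N=1$ for which $P(t_{i-1})$ and $P(t_i)$ always lie in a common simplex (the summands being the distances just defined), and the distance $d(x,y)$ of arbitrary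 points $x,y\in K(\mathcal M)$ is the infimum of the lengths of all paths from $x$ to $y$. Write $d(z):=d(0,z)$, where the element $0$ of $\mathcal M$ is regarded as a vertex of $K(\mathcal M)$. For $x=\sum_p x_p\,p\in K(\mathcal M)$ and $a\in\mathcal M$ put $x\wedge a:=\sum_p x_p\,(p\wedge a)\in K(\mathcal M)$, and let $\tau(x)$ be the maximum element of the support of $x$. Then, for every $x\in K(\mathcal M)$, the distances $d(x\wedge a)$ $(a\in\mathcal M)$ are finite and the function $a\mapsto d(x\wedge a)^2$ is supermodular: $$d(x\wedge a)^2+d(x\wedge b)^2\ \le\ d(x\wedge(a\wedge b))^2+d(x\wedge(a\vee b))^2\qquad(a,b\in\mathcal M).$$ If, in addition, $\tau(x)$ is the maximum element of $\mathcal M$, then this function is strictly increasing: $$d(x\wedge a)^2<d(x\wedge b)^2\qquad(a,b\in\mathcal M,\ a\prec b).$$ -/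

import Mathlib

open scoped ENNReal

noncomputable section

/-- The underlying set `K(P)` of the orthoscheme complex of a poset `P`: all formal convex
combinations `∑ x_p p` of elements of `P` whose nonzero support is a (finite) chain. -/
@[ext]
structure OrthoschemeComplex (P : Type*) [PartialOrder P] where
  coeff : P →₀ ℝ
  nonneg : ∀ p, 0 ≤ coeff p
  sum_eq_one : (coeff.sum fun _ c => c) = 1
  isChain : IsChain (· ≤ ·) (coeff.support : Set P)

namespace OrthoschemeComplex

section Basic

variable {P Q : Type*} [PartialOrder P] [PartialOrder Q]

/-- The vertex of `K(P)` given by an element of `P`. -/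
def vertex (p : P) : OrthoschemeComplex P where
  coeff := Finsupp.single p 1
  nonneg q := by
    classical
    rw [Finsupp.single_apply]
    split_ifs <;> norm_num
  sum_eq_one := by simp
  isChain := by
    rw [Finsupp.support_single p one_ne_zero]
    simp

theorem support_nonempty (x : OrthoschemeComplex P) : x.coeff.support.Nonempty := by
  rw [Finset.nonempty_iff_ne_empty]
  intro h
  have h1 := x.sum_eq_one
  rw [Finsupp.sum, h, Finset.sum_empty] at h1
  exact zero_ne_one h1

theorem exists_isGreatest_support (x : OrthoschemeComplex P) :
    ∃ p, IsGreatest (x.coeff.support : Set P) p := by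
  obtain ⟨p, hp⟩ := x.coeff.support.exists_maximal x.support_nonempty
  refine ⟨p, hp.prop, fun q hq => ?_⟩
  rcases x.isChain.total hq hp.prop with h | h
  · exact h
  · exact hp.le_of_ge hq h

/-- `τ(x)`: the maximum element of the nonzero support of `x`. -/
def tau (x : OrthoschemeComplex P) : P := x.exists_isGreatest_support.choose

theorem isGreatest_tau (x : OrthoschemeComplex P) :
    IsGreatest (x.coeff.support : Set P) x.tau :=
  x.exists_isGreatest_support.choose_spec

/-- The extension `K(P) → K(Q)`, `∑ x_p p ↦ ∑ x_p f(p)`, of an order-preserving map. -/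
def map (f : P →o Q) (x : OrthoschemeComplex P) : OrthoschemeComplex Q where
  coeff := x.coeff.mapDomain f
  nonneg q := by
    classical
    rw [Finsupp.mapDomain, Finsupp.sum_apply]
    refine Finset.sum_nonneg fun p _ => ?_
    simp only [Finsupp.single_apply]
    split_ifs
    · exact x.nonneg p
    · exact le_rfl
  sum_eq_one := by
    rw [Finsupp.sum_mapDomain_index (fun _ => rfl) (fun _ _ _ => rfl)]
    exact x.sum_eq_one
  isChain := by
    classical
    refine IsChain.mono (t := f '' (x.coeff.support : Set P)) ?_ ?_
    · intro q hq
      have h := Finsupp.mapDomain_support hq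
      simpa using h
    · rintro _ ⟨p, hp, rfl⟩ _ ⟨q, hq, rfl⟩ _
      exact (x.isChain.total hp hq).imp (fun h => f.monotone h) (fun h => f.monotone h)

open Classical in
/-- The union of the supports of `x` and `y`. -/
def supp₂ (x y : OrthoschemeComplex P) : Finset P := x.coeff.support ∪ y.coeff.support

theorem supp₂_nonempty (x y : OrthoschemeComplex P) : (supp₂ x y).Nonempty := by
  classical
  exact x.support_nonempty.mono Finset.subset_union_left

/-- `x` and `y` belong to a common simplex; the smallest one is then that of the chain
`supp₂ x y`. -/
def InCommonSimplex (x y : OrthoschemeComplex P) : Prop :=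
  IsChain (· ≤ ·) (supp₂ x y : Set P)

end Basic

section Metric

variable {P : Type*} [PartialOrder P] [GradeOrder ℤ P]

/-- The grade of the minimum element of a nonempty chain `C`
(grades strictly increase along a chain). -/
def minGrade (C : Finset P) (hC : C.Nonempty) : ℤ := C.inf' hC (grade ℤ)

/-- The length of a maximal chain from the minimum to the maximum element of a nonempty
chain `C`. -/
def chainRank (C : Finset P) (hC : C.Nonempty) : ℕ :=
  (C.sup' hC (grade ℤ) - C.inf' hC (grade ℤ)).toNat

/-- The map `φ_Δ` from the simplex `Δ` of a chain `C`, with minimum element `p₀`, to a Euclidean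
space: `x ↦ ∑_{p ∈ C} x_p (e_1 + ⋯ + e_{r[p₀, p]})`, where `r[p₀, p]` is the difference of
the grades of `p` and `p₀`. -/
def phi (C : Finset P) (hC : C.Nonempty) (x : OrthoschemeComplex P) :
    EuclideanSpace ℝ (Fin (chainRank C hC)) :=
  ∑ p ∈ C, x.coeff p • ∑ k : Fin (chainRank C hC),
    if ((k : ℕ) : ℤ) < grade ℤ p - minGrade C hC then EuclideanSpace.single k (1 : ℝ) else 0

/-- The `l₂`-distance of two points of a common simplex, measured in the image of the smallest
common simplex under `phi`. -/
def simplexDist (x y : OrthoschemeComplex P) : ℝ :=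
  ‖phi (supp₂ x y) (supp₂_nonempty x y) x - phi (supp₂ x y) (supp₂_nonempty x y) y‖

/-- The topology of `K(P)` generated by the neighbourhoods that the distances on the simplices
containing a point determine. -/
instance : TopologicalSpace (OrthoschemeComplex P) where
  IsOpen U := ∀ x ∈ U, ∃ ε > 0, ∀ y, InCommonSimplex x y → simplexDist x y < ε → y ∈ U
  isOpen_univ _ _ := ⟨1, one_pos, fun _ _ _ => trivial⟩
  isOpen_inter U V hU hV x hx := by
    obtain ⟨ε, hε, h⟩ := hU x hx.1
    obtain ⟨δ, hδ, h'⟩ := hV x hx.2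
    exact ⟨min ε δ, lt_min hε hδ, fun y hy hd =>
      ⟨h y hy (hd.trans_le (min_le_left _ _)), h' y hy (hd.trans_le (min_le_right _ _))⟩⟩
  isOpen_sUnion S hS x hx := by
    obtain ⟨U, hU, hxU⟩ := hx
    obtain ⟨ε, hε, h⟩ := hS U hU x hxU
    exact ⟨ε, hε, fun y hy hd => ⟨U, hU, h y hy hd⟩⟩

/-- The length of a path: the supremum of `∑ d(P(t_{i-1}), P(t_i))` over all subdivisions
`0 = t_0 < ⋯ < t_N = 1` such that consecutive points belong to a common simplex. -/
def length {x y : OrthoschemeComplex P} (γ : Path x y) : ℝ≥0∞ :=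
  ⨆ (N : ℕ) (t : Fin (N + 1) → unitInterval) (_ : StrictMono t) (_ : t 0 = 0)
    (_ : t (Fin.last N) = 1)
    (_ : ∀ i : Fin N, InCommonSimplex (γ (t i.castSucc)) (γ (t i.succ))),
    ∑ i : Fin N, ENNReal.ofReal (simplexDist (γ (t i.castSucc)) (γ (t i.succ)))

/-- The infimum of the lengths of the paths from `x` to `y`, as an extended real. -/
def pathEDist (x y : OrthoschemeComplex P) : ℝ≥0∞ := ⨅ γ : Path x y, length γ

/-- The distance `d(x, y)` on `K(P)` (meaningful when `pathEDist x y` is finite). -/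
def pathDist (x y : OrthoschemeComplex P) : ℝ := (pathEDist x y).toReal

end Metric

section Lattice

variable {M : Type*} [Lattice M]

/-- `x ∧ a`: the image of `x` under the extension of `p ↦ p ∧ a` to `K(M)`. -/
def meet (x : OrthoschemeComplex M) (a : M) : OrthoschemeComplex M :=
  x.map ⟨fun p => p ⊓ a, fun _ _ h => inf_le_inf_right a h⟩

/-- `d(z) = d(0, z)`, where `0` is the minimum element. -/
def distZero [OrderBot M] [GradeOrder ℤ M] (z : OrthoschemeComplex M) : ℝ :=
  pathDist (vertex ⊥) z

end Lattice

end OrthoschemeComplex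

end

/-! Adjoining 0 to a chain leaves a chain, so 0 and any point z share a simplex; everything rests on
showing that d(z) is the Euclidean distance there. The straight segment gives the upper bound. For
the lower bound, the tail weights t_k(z), the total coefficient in grades above k, are coordinates
defined on all of K(M). On each simplex they agree with the Euclidean ones up to constant
coordinates, so any finite set of them is a 1-Lipschitz map, and subdividing a path into steps
inside simplices shows that no path beats the segment.

Hence d(x ∧ a)² is the sum of t_k(x ∧ a)² over k ≥ r(0). Expanding the squares along the chain gives
`distZero_meet_sq`: d(x ∧ a)² is the sum of x_p x_q (r(p ∧ q ∧ a) - r(0)) over p, q in the support.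
The weights are nonnegative and a ↦ r(p ∧ a) is supermodular because r is a valuation
(`grade_add_grade_eq`), so the sum is supermodular. If τ(x) is the top, its diagonal term is a
positive multiple of r(a) - r(0), which makes the sum strictly increasing. -/

noncomputable section

namespace OrthoschemeComplex

open Finset Topology

/-! ### Segments inside a simplex -/

section CommonSimplex

variable {P : Type*} [PartialOrder P]

theorem support_subset_supp₂_left (x y : OrthoschemeComplex P) :
    x.coeff.support ⊆ supp₂ x y := by
  classical exact subset_union_left

theorem support_subset_supp₂_right (x y : OrthoschemeComplex P) :
    y.coeff.support ⊆ supp₂ x y := by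
  classical exact subset_union_right

theorem mem_supp₂ {x y : OrthoschemeComplex P} {p : P} :
    p ∈ supp₂ x y ↔ p ∈ x.coeff.support ∨ p ∈ y.coeff.support := by
  classical exact mem_union

theorem InCommonSimplex.symm {x y : OrthoschemeComplex P} (h : InCommonSimplex x y) :
    InCommonSimplex y x := by
  classical
  unfold InCommonSimplex at *
  rwa [supp₂, union_comm]

theorem inCommonSimplex_of_support_subset {x y : OrthoschemeComplex P}
    (h : x.coeff.support ⊆ y.coeff.support) : InCommonSimplex x y := by
  classical
  rw [InCommonSimplex, supp₂, union_eq_right.2 h]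
  exact y.isChain

/-- The point at parameter `t` of the straight line from `x` to `y` in a common simplex. -/
def line (x y : OrthoschemeComplex P) (h : InCommonSimplex x y) (t : unitInterval) :
    OrthoschemeComplex P where
  coeff := (1 - t : ℝ) • x.coeff + (t : ℝ) • y.coeff
  nonneg p := add_nonneg (mul_nonneg (sub_nonneg.2 t.2.2) (x.nonneg p))
    (mul_nonneg t.2.1 (y.nonneg p))
  sum_eq_one := by
    rw [Finsupp.sum_add_index' (fun _ => rfl) (fun _ _ _ => rfl),
      Finsupp.sum_smul_index' (fun _ => rfl), Finsupp.sum_smul_index' (fun _ => rfl),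
      ← Finsupp.smul_sum, ← Finsupp.smul_sum, x.sum_eq_one, y.sum_eq_one]
    simp
  isChain := by
    classical
    refine IsChain.mono ?_ h
    rw [coe_subset]
    exact Finsupp.support_add.trans
      (union_subset_union Finsupp.support_smul Finsupp.support_smul)

theorem support_line_subset {x y : OrthoschemeComplex P} (h : InCommonSimplex x y)
    (t : unitInterval) : (line x y h t).coeff.support ⊆ supp₂ x y := by
  classical
  exact Finsupp.support_add.trans (union_subset_union Finsupp.support_smul Finsupp.support_smul)

theorem supp₂_line_subset {x y : OrthoschemeComplex P} (h : InCommonSimplex x y)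
    (s t : unitInterval) : supp₂ (line x y h s) (line x y h t) ⊆ supp₂ x y := by
  classical
  exact union_subset (support_line_subset h s) (support_line_subset h t)

theorem inCommonSimplex_line {x y : OrthoschemeComplex P} (h : InCommonSimplex x y)
    (s t : unitInterval) : InCommonSimplex (line x y h s) (line x y h t) :=
  IsChain.mono (coe_subset.2 (supp₂_line_subset h s t)) h

theorem inCommonSimplex_vertex_bot [OrderBot P] (x : OrthoschemeComplex P) :
    InCommonSimplex (vertex ⊥) x := by
  have hbot : ∀ p ∈ (vertex (⊥ : P)).coeff.support, p = ⊥ := fun p hp => by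
    classical simpa using Finsupp.support_single_subset hp
  intro p hp q hq _
  rw [mem_coe, mem_supp₂] at hp hq
  rcases hp with hp | hp
  · left; rw [hbot p hp]; exact bot_le
  rcases hq with hq | hq
  · right; rw [hbot q hq]; exact bot_le
  · exact x.isChain.total hp hq

end CommonSimplex

/-! ### Tail weights as global coordinates -/

section Tail

variable {P : Type*} [PartialOrder P] [GradeOrder ℤ P]

/-- The total weight of the elements of grade greater than `k`. These numbers are the coordinates
of `x` in the Euclidean model, up to a shift of the index. -/
def tail (x : OrthoschemeComplex P) (k : ℤ) : ℝ :=
  ∑ p ∈ x.coeff.support, if k < grade ℤ p then x.coeff p else 0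

theorem tail_eq_sum_of_subset (x : OrthoschemeComplex P) {C : Finset P}
    (h : x.coeff.support ⊆ C) (k : ℤ) :
    x.tail k = ∑ p ∈ C, if k < grade ℤ p then x.coeff p else 0 := by
  refine sum_subset h fun p _ hp => ?_
  rw [Finsupp.notMem_support_iff.1 hp, ite_self]

theorem tail_map {R : Type*} [PartialOrder R] (f : R →o P) (x : OrthoschemeComplex R) (k : ℤ) :
    (x.map f).tail k =
      ∑ p ∈ x.coeff.support, if k < grade ℤ (f p) then x.coeff p else 0 := by
  have h := Finsupp.sum_mapDomain_index (f := f) (s := x.coeff)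
    (h := fun q c => if k < grade ℤ q then c else 0) (fun _ => by simp)
    (fun q a b => by split_ifs <;> simp)
  exact h

theorem tail_vertex (p : P) (k : ℤ) :
    (vertex p).tail k = if k < grade ℤ p then 1 else 0 := by
  classical
  rw [tail_eq_sum_of_subset (vertex p) (C := {p}) Finsupp.support_single_subset]
  simp [vertex]

theorem tail_eq_one {x : OrthoschemeComplex P} {k : ℤ}
    (h : ∀ p ∈ x.coeff.support, k < grade ℤ p) : x.tail k = 1 := by
  rw [← x.sum_eq_one]
  exact sum_congr rfl fun p hp => if_pos (h p hp)

theorem tail_eq_zero {x : OrthoschemeComplex P} {k : ℤ}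
    (h : ∀ p ∈ x.coeff.support, grade ℤ p ≤ k) : x.tail k = 0 :=
  sum_eq_zero fun p hp => if_neg (h p hp).not_gt

theorem phi_apply (C : Finset P) (hC : C.Nonempty) (x : OrthoschemeComplex P)
    (hx : x.coeff.support ⊆ C) (k : Fin (chainRank C hC)) :
    phi C hC x k = x.tail (minGrade C hC + (k : ℕ)) := by
  rw [tail_eq_sum_of_subset x hx]
  simp only [phi, WithLp.ofLp_sum, Finset.sum_apply, PiLp.smul_apply, smul_eq_mul]
  refine sum_congr rfl fun p _ => ?_
  rw [sum_eq_single k]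
  · by_cases h : ((k : ℕ) : ℤ) < grade ℤ p - minGrade C hC
    · rw [if_pos h, if_pos (by omega)]; simp
    · rw [if_neg h, if_neg (by omega)]; simp
  · intro j _ hj
    split_ifs
    · simp [hj.symm]
    · simp
  · simp

theorem simplexDist_sq_eq_sum_Ico_minGrade (x y : OrthoschemeComplex P) :
    simplexDist x y ^ 2 =
      ∑ k ∈ Ico ((supp₂ x y).inf' (supp₂_nonempty x y) (grade ℤ))
        ((supp₂ x y).sup' (supp₂_nonempty x y) (grade ℤ)), (x.tail k - y.tail k) ^ 2 := by
  rw [simplexDist, EuclideanSpace.norm_sq_eq]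
  simp only [PiLp.sub_apply, phi_apply _ _ _ (support_subset_supp₂_left x y),
    phi_apply _ _ _ (support_subset_supp₂_right x y), Real.norm_eq_abs, sq_abs]
  rw [Fin.sum_univ_eq_sum_range (fun k : ℕ =>
    (x.tail (minGrade _ (supp₂_nonempty x y) + (k : ℤ)) -
      y.tail (minGrade _ (supp₂_nonempty x y) + (k : ℤ))) ^ 2)]
  refine sum_bij (fun k _ => minGrade _ (supp₂_nonempty x y) + (k : ℤ)) ?_ ?_ ?_ ?_
  · intro k hk
    simp only [mem_range, chainRank] at hk
    rw [mem_Ico, minGrade]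
    omega
  · intro a _ b _ h
    simpa using h
  · intro b hb
    rw [mem_Ico] at hb
    refine ⟨(b - minGrade _ (supp₂_nonempty x y)).toNat, ?_, ?_⟩
    · rw [mem_range, chainRank, minGrade]; omega
    · rw [minGrade]; omega
  · intros; rfl

/-- Below the grades of the chain both tails are 1, and from its top grade on both are 0. Index
ranges may therefore be enlarged freely. -/
theorem tail_sub_tail_eq_zero {x y : OrthoschemeComplex P} {k : ℤ}
    (hk : k ∉ Ico ((supp₂ x y).inf' (supp₂_nonempty x y) (grade ℤ))
      ((supp₂ x y).sup' (supp₂_nonempty x y) (grade ℤ))) : x.tail k - y.tail k = 0 := by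
  rw [mem_Ico, not_and_or, not_le, not_lt] at hk
  rcases hk with hk | hk
  · rw [lt_inf'_iff] at hk
    rw [tail_eq_one fun p hp => hk p (support_subset_supp₂_left x y hp),
      tail_eq_one fun p hp => hk p (support_subset_supp₂_right x y hp), sub_self]
  · rw [sup'_le_iff] at hk
    rw [tail_eq_zero fun p hp => hk p (support_subset_supp₂_left x y hp),
      tail_eq_zero fun p hp => hk p (support_subset_supp₂_right x y hp), sub_self]

theorem sum_tail_sub_sq_le (x y : OrthoschemeComplex P) (s : Finset ℤ) :
    ∑ k ∈ s, (x.tail k - y.tail k) ^ 2 ≤ simplexDist x y ^ 2 := by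
  classical
  rw [simplexDist_sq_eq_sum_Ico_minGrade]
  refine (sum_le_sum_of_subset_of_nonneg (subset_union_left (s₁ := s))
    fun _ _ _ => sq_nonneg _).trans_eq (sum_subset subset_union_right fun k _ hk => ?_).symm
  rw [tail_sub_tail_eq_zero hk, zero_pow two_ne_zero]

theorem simplexDist_sq_eq_sum {x y : OrthoschemeComplex P} {a b : ℤ}
    (h : ∀ p ∈ supp₂ x y, a ≤ grade ℤ p ∧ grade ℤ p ≤ b) :
    simplexDist x y ^ 2 = ∑ k ∈ Ico a b, (x.tail k - y.tail k) ^ 2 := by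
  rw [simplexDist_sq_eq_sum_Ico_minGrade]
  refine sum_subset (Ico_subset_Ico ((le_inf'_iff _ _).2 fun p hp => (h p hp).1)
    (sup'_le _ _ fun p hp => (h p hp).2)) fun k _ hk => ?_
  rw [tail_sub_tail_eq_zero hk, zero_pow two_ne_zero]

theorem simplexDist_nonneg (x y : OrthoschemeComplex P) : 0 ≤ simplexDist x y := norm_nonneg _

theorem abs_tail_sub_le (x y : OrthoschemeComplex P) (k : ℤ) :
    |x.tail k - y.tail k| ≤ simplexDist x y := by
  refine abs_le_of_sq_le_sq ?_ (simplexDist_nonneg x y)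
  simpa using sum_tail_sub_sq_le x y {k}

/-- On a chain, the coefficients are differences of consecutive tails. -/
theorem coeff_eq_tail_sub {x : OrthoschemeComplex P} {C : Finset P}
    (hC : IsChain (· ≤ ·) (C : Set P)) (hx : x.coeff.support ⊆ C) {p : P} (hp : p ∈ C) :
    x.coeff p = x.tail (grade ℤ p - 1) - x.tail (grade ℤ p) := by
  rw [tail_eq_sum_of_subset x hx, tail_eq_sum_of_subset x hx, ← sum_sub_distrib,
    sum_eq_single p]
  · simp
  -- Distinct elements of a chain have distinct grades, so both indicators agree at q.
  · intro q hq hqp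
    have hne : grade ℤ q ≠ grade ℤ p := by
      rcases hC.total hq hp with h | h
      · exact (grade_strictMono (𝕆 := ℤ) (lt_of_le_of_ne h hqp)).ne
      · exact (grade_strictMono (𝕆 := ℤ) (lt_of_le_of_ne h hqp.symm)).ne'
    by_cases h : grade ℤ p < grade ℤ q
    · rw [if_pos h, if_pos (by omega), sub_self]
    · rw [if_neg h, if_neg (by omega), sub_self]
  · exact fun h => absurd hp h

theorem abs_coeff_sub_le {x y : OrthoschemeComplex P} (h : InCommonSimplex x y) {p : P}
    (hp : p ∈ supp₂ x y) : |x.coeff p - y.coeff p| ≤ 2 * simplexDist x y := by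
  rw [coeff_eq_tail_sub h (support_subset_supp₂_left x y) hp,
    coeff_eq_tail_sub h (support_subset_supp₂_right x y) hp]
  have h1 := abs_le.1 (abs_tail_sub_le x y (grade ℤ p - 1))
  have h2 := abs_le.1 (abs_tail_sub_le x y (grade ℤ p))
  rw [abs_le]
  constructor <;> linarith

theorem isOpen_setOf_support_subset (x : OrthoschemeComplex P) :
    IsOpen {y : OrthoschemeComplex P | x.coeff.support ⊆ y.coeff.support} := by
  intro y hy
  obtain ⟨p₀, hp₀, hmin⟩ := y.coeff.support.exists_min_image y.coeff y.support_nonempty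
  have hpos : ∀ p ∈ y.coeff.support, 0 < y.coeff p := fun p hp =>
    lt_of_le_of_ne (y.nonneg p) (Finsupp.mem_support_iff.1 hp).symm
  -- Coefficients move by at most twice the distance, so within half the least positive coefficient
  -- none can vanish.
  refine ⟨y.coeff p₀ / 2, half_pos (hpos p₀ hp₀), fun z hz hd p hp => ?_⟩
  have hpy := hy hp
  have h1 := abs_le.1 (abs_coeff_sub_le hz (support_subset_supp₂_left y z hpy))
  have h2 := hmin p hpy
  rw [Finsupp.mem_support_iff]
  intro h0
  linarith [h1.2]

theorem eventually_inCommonSimplex (x : OrthoschemeComplex P) :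
    ∀ᶠ y in 𝓝 x, InCommonSimplex x y :=
  Filter.mem_of_superset ((isOpen_setOf_support_subset x).mem_nhds (Finset.Subset.refl _))
    fun _ hy => inCommonSimplex_of_support_subset hy

end Tail

/-! ### Subdivisions and telescoping -/

/-- Continuous induction on the infimum m of the unreachable parameters. The hypothesis relates t
only to points near it, not those points to each other, so every step must have m as an endpoint:
symmetry reaches m from the left, and a further step from m reaches an allegedly unreachable point.
-/
theorem exists_strictMono_subdivision {R : unitInterval → unitInterval → Prop}
    (hsymm : ∀ s t, R s t → R t s) (hR : ∀ t, ∀ᶠ s in 𝓝 t, R t s) (b : unitInterval) :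
    ∃ (N : ℕ) (t : Fin (N + 1) → unitInterval), StrictMono t ∧ t 0 = 0 ∧ t (Fin.last N) = b ∧
      ∀ i : Fin N, R (t i.castSucc) (t i.succ) := by
  set S : Set unitInterval := {b | ∃ (N : ℕ) (t : Fin (N + 1) → unitInterval),
    StrictMono t ∧ t 0 = 0 ∧ t (Fin.last N) = b ∧ ∀ i : Fin N, R (t i.castSucc) (t i.succ)}
    with hS
  have zero_mem : (0 : unitInterval) ∈ S :=
    ⟨0, fun _ => 0, fun i j h => absurd h (by omega), rfl, rfl, fun i => i.elim0⟩
  have extend : ∀ c ∈ S, ∀ d, c < d → R c d → d ∈ S := by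
    rintro c ⟨N, t, hmono, h0, hlast, ht⟩ d hcd hRcd
    refine ⟨N + 1, Fin.snoc t d, ?_, ?_, Fin.snoc_last _ _, ?_⟩
    · rw [Fin.strictMono_iff_lt_succ]
      intro i
      induction i using Fin.lastCases with
      | last => rw [Fin.snoc_castSucc, Fin.succ_last, Fin.snoc_last, hlast]; exact hcd
      | cast i =>
        rw [Fin.succ_castSucc, Fin.snoc_castSucc, Fin.snoc_castSucc]
        exact hmono Fin.castSucc_lt_succ
    · rw [← Fin.castSucc_zero, Fin.snoc_castSucc, h0]
    · intro i
      induction i using Fin.lastCases with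
      | last => rw [Fin.snoc_castSucc, Fin.succ_last, Fin.snoc_last, hlast]; exact hRcd
      | cast i =>
        rw [Fin.succ_castSucc, Fin.snoc_castSucc, Fin.snoc_castSucc]
        exact ht i
  by_contra hb
  have hne : Sᶜ.Nonempty := ⟨b, hb⟩
  set m := sInf Sᶜ with hm
  have hglb : IsGLB Sᶜ m := isGLB_sInf _
  have hmS : m ∈ S := by
    by_cases h0 : m = 0
    · rw [h0]; exact zero_mem
    have hlt : (0 : unitInterval) < m := unitInterval.pos_iff_ne_zero.2 h0
    have : (𝓝[<] m).NeBot := nhdsLT_neBot_of_exists_lt ⟨0, hlt⟩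
    have hev : ∀ᶠ c in 𝓝[<] m, R m c ∧ c < m :=
      ((hR m).filter_mono nhdsWithin_le_nhds).and self_mem_nhdsWithin
    obtain ⟨c, hc, hcm⟩ := hev.exists
    refine extend c ?_ m hcm (hsymm _ _ hc)
    by_contra hcS
    exact (hglb.1 hcS).not_gt hcm
  obtain ⟨c, hc, hcS⟩ := mem_closure_iff_nhds.1 (hglb.mem_closure hne) _ (hR m)
  refine hcS (extend m hmS c (lt_of_le_of_ne (hglb.1 hcS) ?_) hc)
  rintro rfl
  exact hcS hmS

theorem dist_le_sum_dist_fin {E : Type*} [PseudoMetricSpace E] :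
    ∀ (N : ℕ) (f : Fin (N + 1) → E),
      dist (f 0) (f (Fin.last N)) ≤ ∑ i : Fin N, dist (f i.castSucc) (f i.succ)
  | 0, f => by simp
  | N + 1, f => by
    rw [Fin.sum_univ_castSucc]
    have h := dist_le_sum_dist_fin N (fun i => f i.castSucc)
    exact (dist_triangle _ (f (Fin.last N).castSucc) _).trans (add_le_add_left h _)

theorem sum_succ_sub_castSucc_fin :
    ∀ (N : ℕ) (f : Fin (N + 1) → ℝ),
      ∑ i : Fin N, (f i.succ - f i.castSucc) = f (Fin.last N) - f 0
  | 0, f => by simp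
  | N + 1, f => by
    rw [Fin.sum_univ_castSucc]
    have h := sum_succ_sub_castSucc_fin N (fun i => f i.castSucc)
    simp only [Fin.succ_castSucc, h, Fin.succ_last, Fin.castSucc_zero]
    ring

/-! ### The path metric on a common simplex -/

section Distance

variable {P : Type*} [PartialOrder P] [GradeOrder ℤ P]

/-- The tails of `x` at the indices in `s`, as a Euclidean vector. -/
def tailVec (s : Finset ℤ) (x : OrthoschemeComplex P) : EuclideanSpace ℝ s :=
  WithLp.toLp 2 fun k => x.tail k

theorem dist_tailVec_sq (s : Finset ℤ) (x y : OrthoschemeComplex P) :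
    dist (tailVec s x) (tailVec s y) ^ 2 = ∑ k ∈ s, (x.tail k - y.tail k) ^ 2 := by
  rw [EuclideanSpace.dist_eq, Real.sq_sqrt (sum_nonneg fun _ _ => sq_nonneg _)]
  simp only [tailVec, Real.dist_eq, sq_abs]
  exact Finset.sum_coe_sort s fun k => (x.tail k - y.tail k) ^ 2

theorem dist_tailVec_le (s : Finset ℤ) (x y : OrthoschemeComplex P) :
    dist (tailVec s x) (tailVec s y) ≤ simplexDist x y := by
  refine le_of_sq_le_sq ?_ (simplexDist_nonneg x y)
  rw [dist_tailVec_sq]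
  exact sum_tail_sub_sq_le x y s

theorem exists_dist_tailVec_eq (x y : OrthoschemeComplex P) :
    ∃ s : Finset ℤ, dist (tailVec s x) (tailVec s y) = simplexDist x y :=
  ⟨_, (sq_eq_sq₀ dist_nonneg (simplexDist_nonneg x y)).1
    ((dist_tailVec_sq _ x y).trans (simplexDist_sq_eq_sum_Ico_minGrade x y).symm)⟩

/-- Choose coordinates that realise the distance of the endpoints; the triangle inequality in that
Euclidean space then bounds it by the sum over an admissible subdivision. -/
theorem ofReal_simplexDist_le_length {x y : OrthoschemeComplex P} (γ : Path x y) :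
    ENNReal.ofReal (simplexDist x y) ≤ length γ := by
  obtain ⟨s, hs⟩ := exists_dist_tailVec_eq x y
  obtain ⟨N, t, hmono, h0, h1, ht⟩ := exists_strictMono_subdivision
    (R := fun a b => InCommonSimplex (γ a) (γ b)) (fun _ _ h => h.symm)
    (fun a => γ.continuous.continuousAt.eventually (eventually_inCommonSimplex (γ a))) 1
  have key : simplexDist x y ≤
      ∑ i : Fin N, simplexDist (γ (t i.castSucc)) (γ (t i.succ)) := by
    have h := dist_le_sum_dist_fin N fun i => tailVec s (γ (t i))
    simp only [h0, h1, γ.source, γ.target, hs] at h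
    exact h.trans (sum_le_sum fun i _ => dist_tailVec_le s _ _)
  refine (ENNReal.ofReal_le_ofReal key).trans ?_
  rw [ENNReal.ofReal_sum_of_nonneg fun _ _ => simplexDist_nonneg _ _]
  unfold length
  exact le_iSup_of_le N <| le_iSup_of_le t <| le_iSup_of_le hmono <| le_iSup_of_le h0 <|
    le_iSup_of_le h1 <| le_iSup_of_le ht le_rfl

theorem tail_line {x y : OrthoschemeComplex P} (h : InCommonSimplex x y) (t : unitInterval)
    (k : ℤ) : (line x y h t).tail k = (1 - t) * x.tail k + t * y.tail k := by
  rw [tail_eq_sum_of_subset _ (support_line_subset h t),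
    tail_eq_sum_of_subset x (support_subset_supp₂_left x y),
    tail_eq_sum_of_subset y (support_subset_supp₂_right x y), mul_sum, mul_sum,
    ← sum_add_distrib]
  refine sum_congr rfl fun p _ => ?_
  split_ifs
  · rfl
  · simp

theorem simplexDist_line {x y : OrthoschemeComplex P} (h : InCommonSimplex x y)
    (s t : unitInterval) :
    simplexDist (line x y h s) (line x y h t) = |(t : ℝ) - s| * simplexDist x y := by
  refine (sq_eq_sq₀ (simplexDist_nonneg _ _)
    (mul_nonneg (abs_nonneg _) (simplexDist_nonneg _ _))).1 ?_
  have hb : ∀ p ∈ supp₂ x y,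
      (supp₂ x y).inf' (supp₂_nonempty x y) (grade ℤ) ≤ grade ℤ p ∧
        grade ℤ p ≤ (supp₂ x y).sup' (supp₂_nonempty x y) (grade ℤ) :=
    fun p hp => ⟨inf'_le _ hp, le_sup' _ hp⟩
  rw [mul_pow, sq_abs, simplexDist_sq_eq_sum hb,
    simplexDist_sq_eq_sum fun p hp => hb p (supp₂_line_subset h s t hp), mul_sum]
  refine sum_congr rfl fun k _ => ?_
  rw [tail_line, tail_line]
  ring

theorem continuous_line {x y : OrthoschemeComplex P} (h : InCommonSimplex x y) :
    Continuous (line x y h) := by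
  refine ⟨fun U hU => Metric.isOpen_iff.2 fun t ht => ?_⟩
  obtain ⟨ε, hε, hεU⟩ := hU _ ht
  -- Adding 1 keeps the divisor positive when the endpoints coincide.
  have hd : 0 < simplexDist x y + 1 := by linarith [simplexDist_nonneg x y]
  refine ⟨ε / (simplexDist x y + 1), div_pos hε hd, fun s hs =>
    hεU _ (inCommonSimplex_line h t s) ?_⟩
  rw [Metric.mem_ball, Subtype.dist_eq, Real.dist_eq, lt_div_iff₀ hd] at hs
  rw [simplexDist_line]
  exact (mul_le_mul_of_nonneg_left (le_add_of_nonneg_right zero_le_one) (abs_nonneg _)).trans_lt hs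

/-- The straight path from `x` to `y` in a common simplex. -/
def linePath (x y : OrthoschemeComplex P) (h : InCommonSimplex x y) : Path x y where
  toFun := line x y h
  continuous_toFun := continuous_line h
  source' := by ext p; simp [line]
  target' := by ext p; simp [line]

theorem length_linePath_le {x y : OrthoschemeComplex P} (h : InCommonSimplex x y) :
    length (linePath x y h) ≤ ENNReal.ofReal (simplexDist x y) := by
  refine iSup_le fun N => iSup_le fun t => iSup_le fun hmono => iSup_le fun h0 => iSup_le fun h1 =>
    iSup_le fun _ => ?_
  rw [← ENNReal.ofReal_sum_of_nonneg fun _ _ => simplexDist_nonneg _ _]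
  refine ENNReal.ofReal_le_ofReal (le_of_eq ?_)
  have hsum := sum_succ_sub_castSucc_fin N fun i => (t i : ℝ)
  rw [h0, h1] at hsum
  calc ∑ i : Fin N, simplexDist (line x y h (t i.castSucc)) (line x y h (t i.succ))
      = ∑ i : Fin N, ((t i.succ : ℝ) - t i.castSucc) * simplexDist x y :=
        sum_congr rfl fun i _ => by
          rw [simplexDist_line, abs_of_nonneg]
          exact sub_nonneg.2 (hmono.monotone Fin.castSucc_lt_succ.le)
    _ = simplexDist x y := by rw [← sum_mul, hsum]; simp

/-- On a common simplex the path metric is the Euclidean one. -/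
theorem pathEDist_eq_ofReal_simplexDist {x y : OrthoschemeComplex P} (h : InCommonSimplex x y) :
    pathEDist x y = ENNReal.ofReal (simplexDist x y) :=
  le_antisymm ((iInf_le _ (linePath x y h)).trans (length_linePath_le h))
    (le_iInf fun γ => ofReal_simplexDist_le_length γ)

theorem pathDist_eq_simplexDist {x y : OrthoschemeComplex P} (h : InCommonSimplex x y) :
    pathDist x y = simplexDist x y := by
  rw [pathDist, pathEDist_eq_ofReal_simplexDist h, ENNReal.toReal_ofReal (simplexDist_nonneg x y)]

end Distance

/-! ### The quadratic formula and the modular grade -/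

section Lattice

variable {M : Type*} [Lattice M] [GradeOrder ℤ M]

/-- Summing the squared tails counts each pair of elements of the chain with the smaller grade. -/
theorem distZero_meet_sq [OrderBot M] (x : OrthoschemeComplex M) (a : M) :
    (x.meet a).distZero ^ 2 = ∑ p ∈ x.coeff.support, ∑ q ∈ x.coeff.support,
      x.coeff p * x.coeff q * ((grade ℤ (p ⊓ q ⊓ a) - grade ℤ (⊥ : M) : ℤ) : ℝ) := by
  obtain ⟨b, hb⟩ : ∃ b : ℤ, grade ℤ x.tau ≤ b := ⟨_, le_rfl⟩
  have hgm : Monotone (grade ℤ : M → ℤ) := grade_mono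
  have hxb : ∀ p ∈ x.coeff.support, ∀ c, grade ℤ (p ⊓ c) ≤ b := fun p hp c =>
    (hgm (inf_le_left.trans (x.isGreatest_tau.2 hp))).trans hb
  rw [distZero, pathDist_eq_simplexDist (inCommonSimplex_vertex_bot _),
    simplexDist_sq_eq_sum (a := grade ℤ (⊥ : M)) (b := b)]
  · have htail : ∀ k ∈ Ico (grade ℤ (⊥ : M)) b,
        ((vertex (⊥ : M)).tail k - (x.meet a).tail k) ^ 2 =
          ∑ p ∈ x.coeff.support, ∑ q ∈ x.coeff.support,
            x.coeff p * x.coeff q * if k < grade ℤ (p ⊓ q ⊓ a) then 1 else 0 := by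
      intro k hk
      -- For k ≥ r(0) the tail of the vertex 0 vanishes, leaving a single square to expand.
      rw [tail_vertex, if_neg (mem_Ico.1 hk).1.not_gt, meet, tail_map, zero_sub, neg_sq, sq,
        sum_mul_sum]
      refine sum_congr rfl fun p hp => sum_congr rfl fun q hq => ?_
      change (if k < grade ℤ (p ⊓ a) then x.coeff p else 0) *
        (if k < grade ℤ (q ⊓ a) then x.coeff q else 0) = _
      -- As p and q are comparable, the product of the two indicators is the one for the smaller
      -- element p ∧ q.
      rcases x.isChain.total hp hq with h | h
      · have h' : grade ℤ (p ⊓ a) ≤ grade ℤ (q ⊓ a) := hgm (inf_le_inf_right a h)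
        rw [inf_eq_left.2 h]
        split_ifs <;> first | omega | simp
      · have h' : grade ℤ (q ⊓ a) ≤ grade ℤ (p ⊓ a) := hgm (inf_le_inf_right a h)
        rw [inf_eq_right.2 h]
        split_ifs <;> first | omega | simp
    rw [sum_congr rfl htail, sum_comm]
    refine sum_congr rfl fun p hp => ?_
    rw [sum_comm]
    refine sum_congr rfl fun q _ => ?_
    rw [← mul_sum, sum_boole]
    congr 1
    have hle : grade ℤ (p ⊓ q ⊓ a) ≤ b := by rw [inf_assoc]; exact hxb p hp _
    have hge : grade ℤ (⊥ : M) ≤ grade ℤ (p ⊓ q ⊓ a) := hgm bot_le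
    have hfilter : (Ico (grade ℤ (⊥ : M)) b).filter (fun k => k < grade ℤ (p ⊓ q ⊓ a)) =
        Ico (grade ℤ (⊥ : M)) (grade ℤ (p ⊓ q ⊓ a)) := by
      ext k
      simp only [mem_filter, mem_Ico]
      omega
    rw [hfilter, Int.card_Ico, ← Int.cast_natCast, Int.toNat_of_nonneg (by omega)]
  · classical
    intro p hp
    refine ⟨hgm bot_le, ?_⟩
    rcases mem_supp₂.1 hp with hp | hp
    · have : p = ⊥ := by simpa using Finsupp.support_single_subset hp
      rw [this]
      exact (hgm bot_le).trans hb
    · obtain ⟨q, hq, rfl⟩ := mem_image.1 (Finsupp.mapDomain_support hp)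
      exact hxb q hq a

theorem exists_le_covBy_of_lt {a b : M} (h : a < b) : ∃ c, a ≤ c ∧ c ⋖ b := by
  -- An element of greatest grade in [a, b) is covered by b.
  obtain ⟨n, ⟨c, ⟨hac, hcb⟩, rfl⟩, hmax⟩ := Int.exists_greatest_of_bdd
    (P := fun n => ∃ c : M, (a ≤ c ∧ c < b) ∧ grade ℤ c = n)
    ⟨grade ℤ b, by rintro _ ⟨c, hc, rfl⟩; exact (grade_strictMono hc.2).le⟩ ⟨_, a, ⟨le_rfl, h⟩, rfl⟩
  exact ⟨c, hac, hcb, fun d hcd hdb =>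
    (hmax _ ⟨d, ⟨hac.trans hcd.le, hdb⟩, rfl⟩).not_gt (grade_strictMono hcd)⟩

/-- Descend from u to some w ⋖ u above u ∧ v. The meet with v is unchanged, and u ∧ (w ∨ v) = w by
modularity, so the cover transposes to w ∨ v ⋖ u ∨ v and both sides drop by 1. -/
theorem grade_add_grade_eq [IsModularLattice M] (u v : M) :
    grade ℤ u + grade ℤ v = grade ℤ (u ⊓ v) + grade ℤ (u ⊔ v) := by
  induction hn : (grade ℤ u - grade ℤ (u ⊓ v)).toNat using Nat.strong_induction_on
    generalizing u with
  | _ n ih =>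
    rcases eq_or_lt_of_le (inf_le_left : u ⊓ v ≤ u) with h | h
    · rw [h, sup_eq_right.2 (inf_eq_left.1 h)]
    obtain ⟨w, hw, hwu⟩ := exists_le_covBy_of_lt h
    have hinf : w ⊓ v = u ⊓ v :=
      le_antisymm (inf_le_inf_right v hwu.le) (le_inf hw inf_le_right)
    have hg : grade ℤ w ⋖ grade ℤ u := hwu.grade ℤ
    have hg' : grade ℤ (u ⊓ v) ≤ grade ℤ w := grade_mono hw
    rw [Order.covBy_iff_add_one_eq] at hg
    have hw' := ih _ (by rw [← hn, hinf]; omega) w rfl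
    have hcov : w ⊔ v ⋖ u ⊔ v := by
      have h1 : u ⊓ (w ⊔ v) = w := by
        rw [inf_comm, sup_inf_assoc_of_le v hwu.le, inf_comm, sup_eq_left.2 hw]
      have h2 : u ⊔ (w ⊔ v) = u ⊔ v := by rw [← sup_assoc, sup_eq_left.2 hwu.le]
      rw [← h2]
      exact covBy_sup_of_inf_covBy_left (by rwa [h1])
    have hg2 := hcov.grade ℤ
    rw [Order.covBy_iff_add_one_eq] at hg2
    rw [hinf] at hw'
    omega

/-- The valuation identity for p ∧ a and p ∧ b, with (p ∧ a) ∨ (p ∧ b) ≤ p ∧ (a ∨ b). -/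
theorem grade_inf_supermodular [IsModularLattice M] (p a b : M) :
    grade ℤ (p ⊓ a) + grade ℤ (p ⊓ b) ≤ grade ℤ (p ⊓ (a ⊓ b)) + grade ℤ (p ⊓ (a ⊔ b)) := by
  rw [grade_add_grade_eq, inf_inf_distrib_left p a b]
  have hmono : Monotone (grade ℤ : M → ℤ) := grade_mono
  exact add_le_add_right (hmono le_inf_sup) _

end Lattice

end OrthoschemeComplex

end

theorem mainTheorem7 {M : Type*} [Lattice M] [IsModularLattice M] [OrderBot M] [GradeOrder ℤ M]
    (hfin : ∃ N : ℕ, ∀ s : LTSeries M, s.length ≤ N) (x : OrthoschemeComplex M) :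
    (∀ a : M, OrthoschemeComplex.pathEDist (OrthoschemeComplex.vertex ⊥) (x.meet a) ≠ ⊤) ∧
    (∀ a b : M, (x.meet a).distZero ^ 2 + (x.meet b).distZero ^ 2 ≤
      (x.meet (a ⊓ b)).distZero ^ 2 + (x.meet (a ⊔ b)).distZero ^ 2) ∧
    (IsTop x.tau → ∀ a b : M, a < b → (x.meet a).distZero ^ 2 < (x.meet b).distZero ^ 2) := by
  refine ⟨fun a => ?_, fun a b => ?_, fun htop a b hab => ?_⟩
  · rw [OrthoschemeComplex.pathEDist_eq_ofReal_simplexDist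
      (OrthoschemeComplex.inCommonSimplex_vertex_bot _)]
    exact ENNReal.ofReal_ne_top
  · simp only [OrthoschemeComplex.distZero_meet_sq, ← Finset.sum_add_distrib, ← mul_add]
    refine Finset.sum_le_sum fun p _ => Finset.sum_le_sum fun q _ =>
      mul_le_mul_of_nonneg_left ?_ (mul_nonneg (x.nonneg p) (x.nonneg q))
    have h := OrthoschemeComplex.grade_inf_supermodular (p ⊓ q) a b
    norm_cast
    omega
  · simp only [OrthoschemeComplex.distZero_meet_sq]
    have hle : ∀ p q, x.coeff p * x.coeff q *
          ((grade ℤ (p ⊓ q ⊓ a) - grade ℤ (⊥ : M) : ℤ) : ℝ) ≤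
        x.coeff p * x.coeff q * ((grade ℤ (p ⊓ q ⊓ b) - grade ℤ (⊥ : M) : ℤ) : ℝ) :=
      fun p q => mul_le_mul_of_nonneg_left
        (Int.cast_le.2 (sub_le_sub_right (grade_mono (inf_le_inf_left _ hab.le)) _))
        (mul_nonneg (x.nonneg p) (x.nonneg q))
    have hmem := x.isGreatest_tau.1
    have hpos : 0 < x.coeff x.tau :=
      lt_of_le_of_ne (x.nonneg _) (Finsupp.mem_support_iff.1 hmem).symm
    refine Finset.sum_lt_sum (fun p _ => Finset.sum_le_sum fun q _ => hle p q)
      ⟨x.tau, hmem, Finset.sum_lt_sum (fun q _ => hle _ q) ⟨x.tau, hmem, ?_⟩⟩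
    -- At p = q = τ(x) the meets with a and b are a and b themselves.
    refine mul_lt_mul_of_pos_left (Int.cast_lt.2 (sub_lt_sub_right ?_ _)) (mul_pos hpos hpos)
    rw [inf_idem, inf_eq_right.2 (htop a), inf_eq_right.2 (htop b)]
    exact grade_strictMono hab
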